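/- Let $\mathbb T$ be the unit circle with normalized arc length measure, and view the Hardy space $H^2$ as the closed subspace of $L^2(\mathbb T)$ of functions whose negatively indexed Fourier coefficients vanish. For an inner function $u$ (an element of $H^\infty$ with $|u|=1$ a.e. on $\mathbb T$) let $K_u=H^2\ominus uH^2$ and let $P_{K_u}$ be the orthogonal projection of $L^2(\mathbb T)$ onto $K_u$. For $\varphi\in L^2(\mathbb T)$, if the map $f\mapsto P_{K_u}(\varphi f)$, defined on $K_u\cap H^\infty$, extends to a bounded operator on $K_u$, this operator is denoted $A_\varphi$ and is called a truncated Toeplitz operator (TTO) with symbol $\varphi$; $\mathcal T_u$ denotes the set of all TTOs on $K_u$. For $f,g\in K_u$ write $f\otimes g$ for the operator $h\mapsto\langle h,g\rangle f$ on $K_u$. Theorem. Let $u$ be an inner function with $u(0)=0$, and put $u_1=\bar z u$, so that $u=zu_1$ with $u_1$ inner and $zK_{u_1}\subset K_u$. For $f\in zK_{u_1}$ let $\breve f=z\bar f u_1\in zK_{u_1}$ (the reduced conjugation). Let $\varphi,\psi,\zeta,\eta\in L^2(\mathbb T)$ be symbols of the form $$\varphi=\varphi_++\overline{\varphi_-}+\varphi_0,\quad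 \psi=\psi_++\overline{\psi_-}+\psi_0,\quad \zeta=\zeta_++\overline{\zeta_-}+\zeta_0,\quad \eta=\eta_++\overline{\eta_-}+\eta_0,$$ with $\varphi_\pm,\psi_\pm,\zeta_\pm,\eta_\pm\in zK_{u_1}$ and $\varphi_0,\psi_0,\zeta_0,\eta_0\in\mathbb C$, such that $A_\varphi,A_\psi,A_\zeta,A_\eta$ are bounded, i.e. belong to $\mathcal T_u$. Then $A_\varphi A_\psi-A_\zeta A_\eta\in\mathcal T_u$ if and only if $$\varphi_+\otimes\psi_--\breve\varphi_-\otimes\breve\psi_+=\zeta_+\otimes\eta_--\breve\zeta_-\otimes\breve\eta_+ .$$ -/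

import Mathlib

open MeasureTheory AddCircle
open scoped ENNReal InnerProductSpace

noncomputable section

namespace TruncatedToeplitz

/-- The unit circle `𝕋`, parametrised by `t ↦ e^{2πit}`, with its normalised arc length measure;
`L²(𝕋)` and `L^∞(𝕋)`. -/
abbrev L2 : Type := Lp ℂ 2 (haarAddCircle : Measure UnitAddCircle)

abbrev LInf : Type := Lp ℂ ∞ (haarAddCircle : Measure UnitAddCircle)

/-- The (almost everywhere) pointwise product of a bounded function and an `L²` function. -/
def mul (b : LInf) (f : L2) : L2 := b • f

theorem mul_ae (b : LInf) (f : L2) : ⇑(mul b f) =ᵐ[haarAddCircle] fun t => b t * f t :=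
  Lp.coeFn_lpSMul b f

/-- The coordinate function `z`, as an element of `L^∞(𝕋)`. -/
def zInf : LInf := fourierLp ∞ 1

/-- The constant function `1`, as an element of `L²(𝕋)`. -/
def oneL2 : L2 := fourierLp 2 0

/-- The Hardy space `H²`, as a subspace of `L²(𝕋)`: the functions whose Fourier coefficients of
negative index vanish. -/
def hardySpace : Submodule ℂ L2 where
  carrier := {f | ∀ n : ℤ, n < 0 → fourierCoeff (⇑f) n = 0}
  zero_mem' := fun n _ => by
    rw [← fourierBasis_repr, map_zero]; rfl
  add_mem' := fun {f g} hf hg n hn => by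
    have h1 := hf n hn
    have h2 := hg n hn
    rw [← fourierBasis_repr] at h1 h2 ⊢
    rw [map_add, lp.coeFn_add, Pi.add_apply, h1, h2, add_zero]
  smul_mem' := fun c f hf n hn => by
    have h1 := hf n hn
    rw [← fourierBasis_repr] at h1 ⊢
    rw [map_smul, lp.coeFn_smul, Pi.smul_apply, h1, smul_zero]

/-- Value at the point `w` of the open unit disc of the analytic function `∑ a_n w^n` whose boundary
function is `f`. -/
def diskValue (f : UnitAddCircle → ℂ) (w : ℂ) : ℂ := ∑' n : ℕ, fourierCoeff f (n : ℤ) * w ^ n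

/-- Inner functions, given by their boundary values: elements of `H^∞ ⊆ L^∞(𝕋)` which are unimodular
almost everywhere. -/
structure IsInner (u : LInf) : Prop where
  analytic : ∀ n : ℤ, n < 0 → fourierCoeff (⇑u) n = 0
  unimodular : ∀ᵐ t ∂(haarAddCircle : Measure UnitAddCircle), ‖u t‖ = 1

/-- The subspace `b S = {b f : f ∈ S}` of `L²(𝕋)`. -/
def mulSubmodule (b : LInf) (S : Submodule ℂ L2) : Submodule ℂ L2 where
  carrier := {g | ∃ f ∈ S, mul b f = g}
  zero_mem' := ⟨0, S.zero_mem, by simp [mul]⟩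
  add_mem' := by
    rintro _ _ ⟨f, hf, rfl⟩ ⟨g, hg, rfl⟩
    exact ⟨f + g, S.add_mem hf hg, Lp.add_smul b f g⟩
  smul_mem' := by
    rintro c _ ⟨f, hf, rfl⟩
    exact ⟨c • f, S.smul_mem c hf, by simp only [mul]; exact (Lp.smul_comm c b f).symm⟩

/-- The model space `K_u = H² ⊖ u H²`. -/
def modelSpace (u : LInf) : Submodule ℂ L2 := hardySpace ⊓ (mulSubmodule u hardySpace)ᗮ

theorem isClosed_hardySpace : IsClosed (hardySpace : Set L2) := by
  have h : (hardySpace : Set L2) = ⋂ n : ℤ, ⋂ _ : n < 0, {f : L2 | ⟪fourierLp 2 n, f⟫_ℂ = 0} := by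
    ext f
    simp only [Set.mem_iInter, Set.mem_ofPred_eq, SetLike.mem_coe]
    refine forall_congr' fun n => forall_congr' fun _ => ?_
    rw [← fourierBasis_repr, HilbertBasis.repr_apply_apply, coe_fourierBasis]
  rw [h]
  refine isClosed_iInter fun n => isClosed_iInter fun _ => ?_
  exact isClosed_eq (continuous_const.inner continuous_id) continuous_const

instance instCompleteSpaceModelSpace (u : LInf) : CompleteSpace (modelSpace u) :=
  (isClosed_hardySpace.inter (Submodule.isClosed_orthogonal _)).completeSpace_coe

/-- `A` is the truncated Toeplitz operator `A^u_φ` with symbol `φ ∈ L²(𝕋)`: a bounded operator on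
`K_u` such that `A f = P_{K_u} (φ f)` for every `f ∈ K_u ∩ H^∞` (the bounded function `f` being
called `b` when it is regarded as an element of `L^∞(𝕋)`). -/
def IsTTOWithSymbol (u : LInf) (φ : L2) (A : modelSpace u →L[ℂ] modelSpace u) : Prop :=
  ∀ (f : modelSpace u) (b : LInf), ⇑b =ᵐ[haarAddCircle] ⇑(f : L2) →
    A f = (modelSpace u).orthogonalProjectionOnto (mul b φ)

/-- The set `𝒯_u` of all truncated Toeplitz operators on `K_u`. -/
def ttoSet (u : LInf) : Set (modelSpace u →L[ℂ] modelSpace u) :=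
  {A | ∃ φ : L2, IsTTOWithSymbol u φ A}

/-- The function `u₁ = z̄ u`, so that `u = z u₁`; it is inner when `u` is inner and `u(0) = 0`. -/
def reducedInner (u : LInf) : LInf := (star zInf : LInf) • u

theorem reducedInner_ae (u : LInf) :
    ⇑(reducedInner u) =ᵐ[haarAddCircle] fun t => (starRingEnd ℂ) (zInf t) * u t := by
  filter_upwards [Lp.coeFn_lpSMul (r := ∞) (star zInf : LInf) u, Lp.coeFn_star zInf] with t h1 h2
  rw [reducedInner, h1, Pi.smul_apply', h2]
  rfl

/-- The space `z K_{u₁}`. -/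
def zModelSpace (u : LInf) : Submodule ℂ L2 := mulSubmodule zInf (modelSpace (reducedInner u))

/-- The reduced conjugation `f̆ = z f̄ u₁` (used for `f ∈ z K_{u₁}`). -/
def breve (u : LInf) (f : L2) : L2 := mul zInf (mul (reducedInner u) (star f))

/-- `φ = φ₊ + conj φ₋ + φ₀` with `φ₊, φ₋ ∈ z K_{u₁}` and `φ₀ ∈ ℂ`. -/
structure IsDecomposition (u : LInf) (φ φp φm : L2) (φ₀ : ℂ) : Prop where
  plus_mem : φp ∈ zModelSpace u
  minus_mem : φm ∈ zModelSpace u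
  eq : φ = φp + star φm + φ₀ • oneL2

/-- The rank one operator `f ⊗ g : h ↦ ⟨h, g⟩ f` on `K_u`, for `f, g ∈ K_u`. Its values are written
as elements of `L²(𝕋) ⊇ K_u`. -/
def tensor (u : LInf) (f g : L2) : modelSpace u →L[ℂ] L2 :=
  (InnerProductSpace.rankOne ℂ f g).comp (modelSpace u).subtypeL

theorem tensor_apply (u : LInf) (f g : L2) (h : modelSpace u) :
    tensor u f g h = ⟪g, (h : L2)⟫_ℂ • f := by
  simp [tensor]

end TruncatedToeplitz

end

noncomputable section

namespace TruncatedToeplitz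

open Filter Topology

/-! ### Multiplication operators and conjugation on `L²(𝕋)` -/

/-- Multiplication by a bounded function, as a bounded operator on `L²(𝕋)`. -/
def mulL (b : LInf) : L2 →L[ℂ] L2 :=
  LinearMap.mkContinuous
    { toFun := mul b
      map_add' := fun f g => Lp.add_smul b f g
      map_smul' := fun c f => (Lp.smul_comm c b f).symm }
    ‖b‖ fun f => Lp.norm_smul_le b f

theorem mulL_apply (b : LInf) (f : L2) : mulL b f = mul b f := rfl

theorem mul_add_L2 (b : LInf) (f g : L2) : mul b (f + g) = mul b f + mul b g :=
  (mulL b).map_add f g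

theorem mul_smul_L2 (b : LInf) (c : ℂ) (f : L2) : mul b (c • f) = c • mul b f :=
  (mulL b).map_smul c f

theorem mul_sum_L2 {ι : Type*} (b : LInf) (s : Finset ι) (f : ι → L2) :
    mul b (∑ i ∈ s, f i) = ∑ i ∈ s, mul b (f i) :=
  map_sum (mulL b) f s

theorem star_ae (f : L2) : ⇑(star f) =ᵐ[haarAddCircle] fun t => (starRingEnd ℂ) (f t) :=
  Lp.coeFn_star f

theorem starInf_ae (b : LInf) : ⇑(star b) =ᵐ[haarAddCircle] fun t => (starRingEnd ℂ) (b t) :=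
  Lp.coeFn_star b

theorem smulInf_ae (b c : LInf) : ⇑(b • c : LInf) =ᵐ[haarAddCircle] fun t => b t * c t :=
  Lp.coeFn_lpSMul (r := ∞) b c

theorem mul_comm_mul (b c : LInf) (f : L2) : mul b (mul c f) = mul c (mul b f) := by
  apply Lp.ext
  filter_upwards [mul_ae b (mul c f), mul_ae c (mul b f), mul_ae c f, mul_ae b f] with t h1 h2 h3 h4
  rw [h1, h2, h3, h4]; ring

theorem smulInf_mul (b c : LInf) (f : L2) : mul (b • c : LInf) f = mul b (mul c f) := by
  apply Lp.ext
  filter_upwards [mul_ae b (mul c f), mul_ae (b • c : LInf) f, mul_ae c f, smulInf_ae b c]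
    with t h1 h2 h3 h4
  rw [h1, h2, h3, h4]; ring

theorem add_mul_L2 (b c : LInf) (f : L2) : mul (b + c) f = mul b f + mul c f :=
  Lp.smul_add b c f

theorem sub_mul_L2 (b c : LInf) (f : L2) : mul (b - c) f = mul b f - mul c f := by
  rw [eq_sub_iff_add_eq, ← add_mul_L2, sub_add_cancel]

theorem smul_mul_L2 (a : ℂ) (b : LInf) (f : L2) : mul (a • b) f = a • mul b f :=
  Lp.smul_assoc a b f

theorem star_mul_L2 (b : LInf) (f : L2) : star (mul b f) = mul (star b) (star f) := by
  apply Lp.ext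
  filter_upwards [mul_ae (star b) (star f), star_ae (mul b f), mul_ae b f, star_ae f, starInf_ae b]
    with t h1 h2 h3 h4 h5
  rw [h1, h2, h3, h4, h5, map_mul]

theorem star_add_L2 (f g : L2) : star (f + g) = star f + star g := by
  apply Lp.ext
  filter_upwards [star_ae (f + g), Lp.coeFn_add f g, Lp.coeFn_add (star f) (star g), star_ae f,
    star_ae g] with t h1 h2 h3 h4 h5
  rw [h1, h2, h3, Pi.add_apply, Pi.add_apply, h4, h5, map_add]

theorem star_smul_L2 (c : ℂ) (f : L2) : star (c • f) = (starRingEnd ℂ) c • star f := by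
  apply Lp.ext
  filter_upwards [star_ae (c • f), Lp.coeFn_smul c f, Lp.coeFn_smul (starRingEnd ℂ c) (star f),
    star_ae f] with t h1 h2 h3 h4
  rw [h1, h2, h3, Pi.smul_apply, Pi.smul_apply, h4, smul_eq_mul, smul_eq_mul, map_mul]

theorem inner_star_star (f g : L2) : ⟪star f, star g⟫_ℂ = ⟪g, f⟫_ℂ := by
  rw [L2.inner_def, L2.inner_def]
  apply integral_congr_ae
  filter_upwards [star_ae f, star_ae g] with t h1 h2
  rw [h1, h2]
  simp [RCLike.inner_apply, mul_comm]

theorem inner_star_left (f g : L2) : ⟪star f, g⟫_ℂ = ⟪star g, f⟫_ℂ := by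
  rw [← inner_star_star f (star g), star_star]

theorem inner_mul_left_eq (b : LInf) (f g : L2) : ⟪mul b f, g⟫_ℂ = ⟪f, mul (star b) g⟫_ℂ := by
  rw [L2.inner_def, L2.inner_def]
  apply integral_congr_ae
  filter_upwards [mul_ae b f, mul_ae (star b) g, starInf_ae b] with t h1 h2 h3
  rw [h1, h2, h3]
  simp only [RCLike.inner_apply, map_mul]; ring

theorem inner_mul_right_eq (b : LInf) (f g : L2) : ⟪f, mul b g⟫_ℂ = ⟪mul (star b) f, g⟫_ℂ := by
  rw [inner_mul_left_eq, star_star]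

section Unimodular

variable {b : LInf} (hb : ∀ᵐ t ∂(haarAddCircle : Measure UnitAddCircle), ‖b t‖ = 1)
include hb

theorem star_mul_mul_cancel (f : L2) : mul (star b) (mul b f) = f := by
  apply Lp.ext
  filter_upwards [mul_ae (star b) (mul b f), mul_ae b f, starInf_ae b, hb] with t h1 h2 h3 h4
  rw [h1, h2, h3, ← mul_assoc, ← Complex.normSq_eq_conj_mul_self, Complex.normSq_eq_norm_sq, h4]
  simp

theorem mul_star_mul_cancel (f : L2) : mul b (mul (star b) f) = f := by
  rw [mul_comm_mul, star_mul_mul_cancel hb]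

theorem inner_mul_mul (f g : L2) : ⟪mul b f, mul b g⟫_ℂ = ⟪f, g⟫_ℂ := by
  rw [inner_mul_left_eq, star_mul_mul_cancel hb]

end Unimodular

/-! ### The Fourier basis -/

theorem fourierInf_ae (n : ℤ) : ⇑(fourierLp ∞ n : LInf) =ᵐ[haarAddCircle] fourier n :=
  coeFn_fourierLp ∞ n

theorem fourierInf_unimodular (n : ℤ) :
    ∀ᵐ t ∂(haarAddCircle : Measure UnitAddCircle), ‖(fourierLp ∞ n : LInf) t‖ = 1 := by
  filter_upwards [fourierInf_ae n] with t h
  rw [h, fourier_apply]; exact Circle.norm_coe _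

theorem zInf_unimodular : ∀ᵐ t ∂(haarAddCircle : Measure UnitAddCircle), ‖zInf t‖ = 1 :=
  fourierInf_unimodular 1

theorem fourierInf_mul_fourierLp (m n : ℤ) :
    mul (fourierLp ∞ m) (fourierLp 2 n) = fourierLp 2 (m + n) := by
  apply Lp.ext
  filter_upwards [mul_ae (fourierLp ∞ m) (fourierLp 2 n), fourierInf_ae m,
    coeFn_fourierLp (T := 1) 2 n, coeFn_fourierLp (T := 1) 2 (m + n)] with t h1 h2 h3 h4
  rw [h1, h2, h3, h4, fourier_add]

theorem zInf_mul_fourierLp (n : ℤ) : mul zInf (fourierLp 2 n) = fourierLp 2 (n + 1) := by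
  rw [zInf, fourierInf_mul_fourierLp, add_comm]

theorem star_zInf_mul_fourierLp (n : ℤ) :
    mul (star zInf) (fourierLp 2 n) = fourierLp 2 (n - 1) := by
  rw [show n = (n - 1) + 1 by ring, ← zInf_mul_fourierLp, star_mul_mul_cancel zInf_unimodular]
  simp

theorem fourierInf_mul_one (n : ℤ) : mul (fourierLp ∞ n) oneL2 = fourierLp 2 n := by
  rw [oneL2, fourierInf_mul_fourierLp, add_zero]

theorem star_fourierLp (n : ℤ) : star (fourierLp 2 n : L2) = fourierLp 2 (-n) := by
  apply Lp.ext
  filter_upwards [star_ae (fourierLp 2 n), coeFn_fourierLp (T := 1) 2 n,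
    coeFn_fourierLp (T := 1) 2 (-n)] with t h1 h2 h3
  rw [h1, h2, h3, fourier_neg]

theorem star_one_L2 : star oneL2 = oneL2 := by
  rw [oneL2, star_fourierLp, neg_zero]

theorem mul_one_ae (b : LInf) : ⇑(mul b oneL2) =ᵐ[haarAddCircle] ⇑b := by
  filter_upwards [mul_ae b oneL2, coeFn_fourierLp (T := 1) 2 0] with t h1 h2
  rw [h1, oneL2, h2, fourier_zero, mul_one]

theorem ae_eq_iff_eq_mul_one (b : LInf) (f : L2) :
    ⇑b =ᵐ[haarAddCircle] ⇑f ↔ f = mul b oneL2 := by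
  constructor
  · intro h
    exact Lp.ext (h.symm.trans (mul_one_ae b).symm)
  · rintro rfl
    exact (mul_one_ae b).symm

theorem fourierCoeff_eq_inner (f : L2) (n : ℤ) : fourierCoeff (⇑f) n = ⟪fourierLp 2 n, f⟫_ℂ := by
  rw [← fourierBasis_repr, HilbertBasis.repr_apply_apply, coe_fourierBasis]

theorem fourierCoeffInf_eq_inner (b : LInf) (n : ℤ) :
    fourierCoeff (⇑b) n = ⟪fourierLp 2 n, mul b oneL2⟫_ℂ := by
  rw [← fourierCoeff_eq_inner, fourierCoeff_congr_ae (mul_one_ae b)]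

theorem inner_fourierLp (m n : ℤ) :
    ⟪(fourierLp 2 m : L2), fourierLp 2 n⟫_ℂ = if m = n then 1 else 0 :=
  orthonormal_iff_ite.mp orthonormal_fourier m n

theorem inner_one_one : ⟪oneL2, oneL2⟫_ℂ = 1 := by
  rw [oneL2, inner_fourierLp, if_pos rfl]

theorem hasSum_inner (f g : L2) :
    HasSum (fun n : ℤ => ⟪f, fourierLp 2 n⟫_ℂ * ⟪fourierLp 2 n, g⟫_ℂ) ⟪f, g⟫_ℂ := by
  simpa [coe_fourierBasis] using (fourierBasis (T := 1)).hasSum_inner_mul_inner f g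

theorem hasSum_fourierLp (f : L2) :
    HasSum (fun n : ℤ => ⟪fourierLp 2 n, f⟫_ℂ • (fourierLp 2 n : L2)) f := by
  simpa [HilbertBasis.repr_apply_apply, coe_fourierBasis] using
    (fourierBasis (T := 1)).hasSum_repr f

theorem inner_eq_zero_of_fourier {f g : L2}
    (h : ∀ n : ℤ, ⟪fourierLp 2 n, f⟫_ℂ = 0 ∨ ⟪fourierLp 2 n, g⟫_ℂ = 0) : ⟪f, g⟫_ℂ = 0 := by
  refine (hasSum_inner f g).unique ?_
  convert! hasSum_zero with n
  rcases h n with h | h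
  · rw [inner_eq_zero_symm.mp h, zero_mul]
  · rw [h, mul_zero]

theorem eq_zero_of_fourier {f : L2} (h : ∀ n : ℤ, ⟪fourierLp 2 n, f⟫_ℂ = 0) : f = 0 :=
  inner_self_eq_zero.mp (inner_eq_zero_of_fourier fun n => Or.inl (h n))

theorem inner_fourierLp_star (f : L2) (n : ℤ) :
    ⟪fourierLp 2 n, star f⟫_ℂ = ⟪f, fourierLp 2 (-n)⟫_ℂ := by
  rw [← inner_star_star, star_star, star_fourierLp]

/-! ### The Hardy space -/

theorem mem_hardySpace {f : L2} :
    f ∈ hardySpace ↔ ∀ n : ℤ, n < 0 → ⟪fourierLp 2 n, f⟫_ℂ = 0 := by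
  simp only [← fourierCoeff_eq_inner]; rfl

theorem fourierLp_mem_hardySpace {n : ℤ} (hn : 0 ≤ n) : (fourierLp 2 n : L2) ∈ hardySpace :=
  mem_hardySpace.mpr fun m hm => by rw [inner_fourierLp, if_neg (by lia)]

theorem one_mem_hardySpace : oneL2 ∈ hardySpace := fourierLp_mem_hardySpace le_rfl

theorem inner_fourierLp_mul_fourierLp (b : LInf) (m n : ℤ) :
    ⟪fourierLp 2 n, mul b (fourierLp 2 m)⟫_ℂ = fourierCoeff (⇑b) (n - m) := by
  rw [fourierCoeffInf_eq_inner,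
    ← inner_mul_mul (fourierInf_unimodular m) (fourierLp 2 (n - m)), fourierInf_mul_fourierLp,
    mul_comm_mul, fourierInf_mul_one, add_sub_cancel]

/-- An analytic bounded function multiplies `H²` into itself. -/
theorem mul_mem_hardySpace {b : LInf} (hb : ∀ n : ℤ, n < 0 → fourierCoeff (⇑b) n = 0) {f : L2}
    (hf : f ∈ hardySpace) : mul b f ∈ hardySpace := by
  rw [mem_hardySpace] at hf ⊢
  intro n hn
  rw [inner_mul_right_eq]
  refine inner_eq_zero_of_fourier fun m => ?_
  by_cases hm : m < 0
  · exact Or.inr (hf m hm)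
  · left
    rw [inner_eq_zero_symm, inner_mul_left_eq, star_star, inner_fourierLp_mul_fourierLp]
    exact hb _ (by lia)

theorem isInner_zInf : IsInner zInf where
  analytic n hn := by
    rw [fourierCoeffInf_eq_inner, zInf, fourierInf_mul_one, inner_fourierLp, if_neg (by lia)]
  unimodular := zInf_unimodular

theorem zInf_mul_mem_hardySpace {f : L2} (hf : f ∈ hardySpace) : mul zInf f ∈ hardySpace :=
  mul_mem_hardySpace isInner_zInf.analytic hf

theorem inner_one_zInf_mul {f : L2} (hf : f ∈ hardySpace) : ⟪oneL2, mul zInf f⟫_ℂ = 0 := by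
  rw [inner_mul_right_eq, oneL2, star_zInf_mul_fourierLp]
  exact mem_hardySpace.mp hf _ (by norm_num)

theorem star_zInf_mul_mem_hardySpace {f : L2} (hf : f ∈ hardySpace) (h0 : ⟪oneL2, f⟫_ℂ = 0) :
    mul (star zInf) f ∈ hardySpace := by
  rw [mem_hardySpace] at hf ⊢
  intro n hn
  rw [inner_mul_right_eq, star_star, zInf_mul_fourierLp]
  rcases (show n + 1 < 0 ∨ n + 1 = 0 by lia) with h | h
  · exact hf _ h
  · rw [h]; exact h0

theorem inner_one_sub (f : L2) : ⟪oneL2, f - ⟪oneL2, f⟫_ℂ • oneL2⟫_ℂ = 0 := by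
  rw [inner_sub_right, inner_smul_right, inner_one_one, mul_one, sub_self]

theorem inner_star_eq_zero {f g : L2} (hf : f ∈ hardySpace) (hg : g ∈ hardySpace)
    (h0 : ⟪oneL2, g⟫_ℂ = 0) : ⟪f, star g⟫_ℂ = 0 := by
  refine inner_eq_zero_of_fourier fun n => ?_
  rcases lt_trichotomy n 0 with h | rfl | h
  · exact Or.inl (mem_hardySpace.mp hf n h)
  · right; rw [inner_fourierLp_star, neg_zero, inner_eq_zero_symm]; exact h0
  · right
    rw [inner_fourierLp_star, inner_eq_zero_symm]; exact mem_hardySpace.mp hg _ (by lia)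

/-! ### Model spaces -/

theorem mem_modelSpace {v : LInf} {f : L2} :
    f ∈ modelSpace v ↔ f ∈ hardySpace ∧ ∀ h ∈ hardySpace, ⟪mul v h, f⟫_ℂ = 0 := by
  rw [modelSpace, Submodule.mem_inf, Submodule.mem_orthogonal]
  refine and_congr_right fun _ => ⟨fun H h hh => H _ ⟨h, hh, rfl⟩, ?_⟩
  rintro H _ ⟨h, hh, rfl⟩
  exact H h hh

/-- Bounded functions are total in the model space of an inner function. -/
theorem eq_zero_of_inner_bounded {v : LInf} (hv : IsInner v) {x : L2} (hx : x ∈ modelSpace v)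
    (H : ∀ b : LInf, mul b oneL2 ∈ modelSpace v → ⟪mul b oneL2, x⟫_ℂ = 0) : x = 0 := by
  obtain ⟨hxH, hxv⟩ := mem_modelSpace.mp hx
  refine eq_zero_of_fourier fun n => ?_
  rcases lt_or_ge n 0 with hn | hn
  · exact mem_hardySpace.mp hxH n hn
  set c : ℤ → ℂ := fun k => ⟪fourierLp 2 k, mul (star v) (fourierLp 2 n)⟫_ℂ with hc
  set p : LInf := ∑ k ∈ Finset.Icc 0 n, c k • (fourierLp ∞ k : LInf)
  set q : L2 := ∑ k ∈ Finset.Icc 0 n, c k • (fourierLp 2 k : L2) with hq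
  have hpq : mul p oneL2 = q := by
    have : ∀ s : Finset ℤ, mul (∑ k ∈ s, c k • (fourierLp ∞ k : LInf)) oneL2
        = ∑ k ∈ s, c k • (fourierLp 2 k : L2) := by
      intro s
      induction s using Finset.cons_induction with
      | empty => exact Lp.zero_smul (p := ∞) ℂ oneL2
      | cons k s hk ih =>
        rw [Finset.sum_cons, Finset.sum_cons, add_mul_L2, ih, smul_mul_L2, fourierInf_mul_one]
    exact this _
  have hqH : q ∈ hardySpace := Submodule.sum_mem _ fun k hk =>
    Submodule.smul_mem _ _ (fourierLp_mem_hardySpace (Finset.mem_Icc.mp hk).1)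
  have hb : mul (fourierLp ∞ n - (v • p : LInf)) oneL2 = fourierLp 2 n - mul v q := by
    rw [sub_mul_L2, smulInf_mul, hpq, fourierInf_mul_one]
  have hmem : fourierLp 2 n - mul v q ∈ modelSpace v := by
    refine mem_modelSpace.mpr ⟨Submodule.sub_mem _ (fourierLp_mem_hardySpace hn)
      (mul_mem_hardySpace hv.analytic hqH), fun h hh => ?_⟩
    rw [inner_sub_right, inner_mul_mul hv.unimodular, inner_mul_left_eq, ← inner_sub_right]
    refine inner_eq_zero_of_fourier fun k => ?_
    rcases lt_or_ge k 0 with hk | hk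
    · exact Or.inl (mem_hardySpace.mp hh k hk)
    right
    rw [inner_sub_right, hq, inner_sum]
    simp only [inner_smul_right, inner_fourierLp]
    rcases le_or_gt k n with hkn | hkn
    · rw [Finset.sum_eq_single k]
      · simp [hc]
      · intro j _ hj; rw [if_neg (Ne.symm hj), mul_zero]
      · intro h'; exact absurd (Finset.mem_Icc.mpr ⟨hk, hkn⟩) h'
    · rw [Finset.sum_eq_zero, sub_zero]
      · rw [← inner_mul_left_eq, inner_eq_zero_symm, inner_fourierLp_mul_fourierLp]
        exact hv.analytic _ (by lia)
      · intro j hj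
        rw [if_neg, mul_zero]
        have := (Finset.mem_Icc.mp hj).2
        lia
  have h1 := H _ (by rw [hb]; exact hmem)
  rwa [hb, inner_sub_left, hxv q hqH, sub_zero] at h1

/-- Continuous functionals on a model space are determined by their values on bounded functions. -/
theorem functional_ext {v : LInf} (hv : IsInner v) {F G : modelSpace v →L[ℂ] ℂ}
    (H : ∀ (f : modelSpace v) (b : LInf), (f : L2) = mul b oneL2 → F f = G f) (f : modelSpace v) :
    F f = G f := by
  have hy : (InnerProductSpace.toDual ℂ (modelSpace v)).symm (F - G) = 0 := by
    refine Subtype.ext (eq_zero_of_inner_bounded hv (Subtype.property _) fun b hb => ?_)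
    have h1 := H ⟨_, hb⟩ b rfl
    rw [← sub_eq_zero, ← sub_apply,
      ← InnerProductSpace.toDual_symm_apply, inner_eq_zero_symm] at h1
    exact h1
  rw [LinearIsometryEquiv.map_eq_zero_iff, sub_eq_zero] at hy
  rw [hy]

section Reduced

variable {u : LInf} (hu : IsInner u) (hu0 : diskValue (⇑u) 0 = 0)

theorem zInf_mul_reducedInner_mul (u : LInf) (f : L2) :
    mul zInf (mul (reducedInner u) f) = mul u f := by
  rw [reducedInner, smulInf_mul, mul_star_mul_cancel zInf_unimodular]

theorem reducedInner_mul_zInf_mul (u : LInf) (f : L2) :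
    mul (reducedInner u) (mul zInf f) = mul u f := by
  rw [mul_comm_mul, zInf_mul_reducedInner_mul]

include hu hu0 in
theorem isInner_reducedInner : IsInner (reducedInner u) where
  analytic n hn := by
    have h0 : fourierCoeff (⇑u) 0 = 0 := by
      rw [← hu0, diskValue, tsum_eq_single 0]
      · simp
      · intro n hn; simp [hn]
    rw [fourierCoeffInf_eq_inner, ← inner_mul_mul zInf_unimodular, zInf_mul_reducedInner_mul,
      zInf_mul_fourierLp, ← fourierCoeffInf_eq_inner]
    rcases (show n + 1 < 0 ∨ n + 1 = 0 by lia) with h | h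
    · exact hu.analytic _ h
    · rw [h, h0]
  unimodular := by
    filter_upwards [reducedInner_ae u, hu.unimodular, zInf_unimodular] with t h1 h2 h3
    rw [h1, norm_mul, RCLike.norm_conj, h2, h3, mul_one]

include hu hu0 in
theorem reducedInner_mul_mem_hardySpace {f : L2} (hf : f ∈ hardySpace) :
    mul (reducedInner u) f ∈ hardySpace :=
  mul_mem_hardySpace (isInner_reducedInner hu hu0).analytic hf

include hu hu0 in
theorem inner_reducedInner_mul_mul (f g : L2) :
    ⟪mul (reducedInner u) f, mul (reducedInner u) g⟫_ℂ = ⟪f, g⟫_ℂ :=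
  inner_mul_mul (isInner_reducedInner hu hu0).unimodular f g

include hu hu0 in
theorem one_mem_modelSpace : oneL2 ∈ modelSpace u := by
  refine mem_modelSpace.mpr ⟨one_mem_hardySpace, fun h hh => ?_⟩
  rw [inner_eq_zero_symm, ← zInf_mul_reducedInner_mul]
  exact inner_one_zInf_mul (reducedInner_mul_mem_hardySpace hu hu0 hh)

include hu hu0 in
theorem reducedInner_mem_modelSpace : mul (reducedInner u) oneL2 ∈ modelSpace u := by
  refine mem_modelSpace.mpr
    ⟨reducedInner_mul_mem_hardySpace hu hu0 one_mem_hardySpace, fun h hh => ?_⟩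
  rw [← reducedInner_mul_zInf_mul, inner_reducedInner_mul_mul hu hu0, inner_eq_zero_symm]
  exact inner_one_zInf_mul hh

theorem mem_modelSpace_of_reduced {f : L2} (hf : f ∈ modelSpace (reducedInner u)) :
    f ∈ modelSpace u := by
  rw [mem_modelSpace] at hf ⊢
  refine ⟨hf.1, fun h hh => ?_⟩
  rw [← reducedInner_mul_zInf_mul]
  exact hf.2 _ (zInf_mul_mem_hardySpace hh)

theorem zInf_mul_mem_modelSpace {f : L2} (hf : f ∈ modelSpace (reducedInner u)) :
    mul zInf f ∈ modelSpace u := by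
  rw [mem_modelSpace] at hf ⊢
  refine ⟨zInf_mul_mem_hardySpace hf.1, fun h hh => ?_⟩
  rw [← zInf_mul_reducedInner_mul, inner_mul_mul zInf_unimodular]
  exact hf.2 h hh

theorem star_zInf_mul_mem_modelSpace {f : L2} (hf : f ∈ modelSpace u) (h0 : ⟪oneL2, f⟫_ℂ = 0) :
    mul (star zInf) f ∈ modelSpace (reducedInner u) := by
  rw [mem_modelSpace] at hf ⊢
  refine ⟨star_zInf_mul_mem_hardySpace hf.1 h0, fun h hh => ?_⟩
  rw [inner_mul_right_eq, star_star, zInf_mul_reducedInner_mul]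
  exact hf.2 h hh

theorem mem_reduced_modelSpace {f : L2} (hf : f ∈ modelSpace u)
    (h0 : ⟪mul (reducedInner u) oneL2, f⟫_ℂ = 0) : f ∈ modelSpace (reducedInner u) := by
  rw [mem_modelSpace] at hf ⊢
  refine ⟨hf.1, fun h hh => ?_⟩
  have h1 : h = ⟪oneL2, h⟫_ℂ • oneL2 + mul zInf (mul (star zInf) (h - ⟪oneL2, h⟫_ℂ • oneL2)) := by
    rw [mul_star_mul_cancel zInf_unimodular, add_sub_cancel]
  rw [h1, mul_add_L2, mul_smul_L2, reducedInner_mul_zInf_mul, inner_add_left, inner_smul_left, h0,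
    mul_zero, zero_add]
  exact hf.2 _ (star_zInf_mul_mem_hardySpace
    (Submodule.sub_mem _ hh (Submodule.smul_mem _ _ one_mem_hardySpace)) (inner_one_sub h))

theorem inner_reducedInner_eq_zero {f : L2} (hf : f ∈ modelSpace (reducedInner u)) :
    ⟪mul (reducedInner u) oneL2, f⟫_ℂ = 0 :=
  (mem_modelSpace.mp hf).2 _ one_mem_hardySpace

variable (u) in
/-- The inclusion `K_{u₁} ⊆ K_u`. -/
def inclusion : modelSpace (reducedInner u) →L[ℂ] modelSpace u :=
  (modelSpace (reducedInner u)).subtypeL.codRestrict _ fun f =>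
    mem_modelSpace_of_reduced (by rw [Submodule.subtypeL_apply]; exact f.2)

variable (u) in
/-- Multiplication by `z`, as an operator from `K_{u₁}` to `K_u`. -/
def zShift : modelSpace (reducedInner u) →L[ℂ] modelSpace u :=
  ((mulL zInf).comp (modelSpace (reducedInner u)).subtypeL).codRestrict _
    fun f => by
      rw [ContinuousLinearMap.comp_apply, Submodule.subtypeL_apply, mulL_apply]
      exact zInf_mul_mem_modelSpace f.2

@[simp] theorem coe_inclusion (f : modelSpace (reducedInner u)) :
    (inclusion u f : L2) = f := by
  rw [inclusion, ContinuousLinearMap.coe_codRestrict_apply, Submodule.subtypeL_apply]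

@[simp] theorem coe_zShift (f : modelSpace (reducedInner u)) :
    (zShift u f : L2) = mul zInf f := by
  rw [zShift, ContinuousLinearMap.coe_codRestrict_apply, ContinuousLinearMap.comp_apply,
    Submodule.subtypeL_apply, mulL_apply]

/-- The constant function `1`, as an element of `K_u`. -/
def modelOne (hu : IsInner u) (hu0 : diskValue (⇑u) 0 = 0) : modelSpace u :=
  ⟨oneL2, one_mem_modelSpace hu hu0⟩

/-- The function `u₁`, as an element of `K_u`. -/
def modelReduced (hu : IsInner u) (hu0 : diskValue (⇑u) 0 = 0) : modelSpace u :=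
  ⟨mul (reducedInner u) oneL2, reducedInner_mem_modelSpace hu hu0⟩

@[simp] theorem coe_modelOne : (modelOne hu hu0 : L2) = oneL2 := rfl

@[simp] theorem coe_modelReduced :
    (modelReduced hu hu0 : L2) = mul (reducedInner u) oneL2 := rfl

theorem model_inner_smul_right (x y : modelSpace u) (c : ℂ) : ⟪x, c • y⟫_ℂ = c * ⟪x, y⟫_ℂ := by
  rw [Submodule.coe_inner, Submodule.coe_smul, inner_smul_right, Submodule.coe_inner]

theorem model_inner_smul_left (x y : modelSpace u) (c : ℂ) :
    ⟪c • x, y⟫_ℂ = (starRingEnd ℂ) c * ⟪x, y⟫_ℂ := by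
  rw [Submodule.coe_inner, Submodule.coe_smul, inner_smul_left, Submodule.coe_inner]

theorem model_inner_conj_symm (x y : modelSpace u) : (starRingEnd ℂ) ⟪y, x⟫_ℂ = ⟪x, y⟫_ℂ := by
  rw [Submodule.coe_inner, Submodule.coe_inner, inner_conj_symm]

theorem norm_model_inner_le (x y : modelSpace u) : ‖⟪x, y⟫_ℂ‖ ≤ ‖x‖ * ‖y‖ := by
  rw [Submodule.coe_inner]
  exact norm_inner_le_norm (x : L2) y

theorem inner_projection (x : modelSpace u) (v : L2) :
    ⟪x, (modelSpace u).orthogonalProjectionOnto v⟫_ℂ = ⟪(x : L2), v⟫_ℂ :=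
  Submodule.inner_orthogonalProjectionOnto_eq_of_mem_left x v

theorem inner_modelOne_modelOne : ⟪modelOne hu hu0, modelOne hu hu0⟫_ℂ = 1 := by
  rw [Submodule.coe_inner, coe_modelOne, inner_one_one]

theorem inner_modelReduced_modelReduced : ⟪modelReduced hu hu0, modelReduced hu hu0⟫_ℂ = 1 := by
  rw [Submodule.coe_inner, coe_modelReduced, inner_reducedInner_mul_mul hu hu0, inner_one_one]

theorem inner_zShift_zShift (f g : modelSpace (reducedInner u)) :
    ⟪zShift u f, zShift u g⟫_ℂ = ⟪f, g⟫_ℂ := by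
  rw [Submodule.coe_inner, Submodule.coe_inner, coe_zShift, coe_zShift,
    inner_mul_mul zInf_unimodular]

theorem inner_inclusion_inclusion (f g : modelSpace (reducedInner u)) :
    ⟪inclusion u f, inclusion u g⟫_ℂ = ⟪f, g⟫_ℂ := by
  rw [Submodule.coe_inner, Submodule.coe_inner, coe_inclusion, coe_inclusion]

theorem inner_modelOne_zShift (f : modelSpace (reducedInner u)) :
    ⟪modelOne hu hu0, zShift u f⟫_ℂ = 0 := by
  rw [Submodule.coe_inner, coe_zShift, coe_modelOne]
  exact inner_one_zInf_mul (mem_modelSpace.mp f.2).1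

theorem inner_modelReduced_inclusion (f : modelSpace (reducedInner u)) :
    ⟪modelReduced hu hu0, inclusion u f⟫_ℂ = 0 := by
  rw [Submodule.coe_inner, coe_inclusion, coe_modelReduced]
  exact inner_reducedInner_eq_zero f.2

/-- `K_u = ℂ ⊕ z K_{u₁}`. -/
theorem exists_eq_modelOne_add_zShift (f : modelSpace u) :
    ∃ h : modelSpace (reducedInner u),
      f = ⟪modelOne hu hu0, f⟫_ℂ • modelOne hu hu0 + zShift u h := by
  set r : modelSpace u := f - ⟪modelOne hu hu0, f⟫_ℂ • modelOne hu hu0 with hr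
  have hr0 : ⟪modelOne hu hu0, r⟫_ℂ = 0 := by
    rw [hr, inner_sub_right, model_inner_smul_right, inner_modelOne_modelOne, mul_one, sub_self]
  rw [Submodule.coe_inner, coe_modelOne] at hr0
  refine ⟨⟨mul (star zInf) r, star_zInf_mul_mem_modelSpace r.2 hr0⟩, ?_⟩
  rw [← sub_eq_iff_eq_add', ← hr]
  exact Subtype.ext (by rw [coe_zShift, mul_star_mul_cancel zInf_unimodular])

/-- `K_u = ℂ u₁ ⊕ K_{u₁}`. -/
theorem exists_eq_modelReduced_add_inclusion (f : modelSpace u) :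
    ∃ h : modelSpace (reducedInner u),
      f = ⟪modelReduced hu hu0, f⟫_ℂ • modelReduced hu hu0 + inclusion u h := by
  set r : modelSpace u := f - ⟪modelReduced hu hu0, f⟫_ℂ • modelReduced hu hu0 with hr
  have hr0 : ⟪modelReduced hu hu0, r⟫_ℂ = 0 := by
    rw [hr, inner_sub_right, model_inner_smul_right, inner_modelReduced_modelReduced, mul_one,
      sub_self]
  rw [Submodule.coe_inner, coe_modelReduced] at hr0
  refine ⟨⟨r, mem_reduced_modelSpace r.2 hr0⟩, ?_⟩
  rw [← sub_eq_iff_eq_add', ← hr]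
  exact Subtype.ext (by rw [coe_inclusion])

end Reduced

/-! ### Shift invariance characterises truncated Toeplitz operators -/

theorem inner_tto {u : LInf} {φ : L2} {A : modelSpace u →L[ℂ] modelSpace u}
    (hA : IsTTOWithSymbol u φ A) (g f : modelSpace u) (b : LInf) (hb : (f : L2) = mul b oneL2) :
    ⟪g, A f⟫_ℂ = ⟪(g : L2), mul b φ⟫_ℂ := by
  rw [hA f b ((ae_eq_iff_eq_mul_one b f).mpr hb), inner_projection]

/-- The form `⟨A f, g⟩` is unchanged when `f` and `g` are multiplied by `z`. -/
def ShiftInvariant (u : LInf) (A : modelSpace u →L[ℂ] modelSpace u) : Prop :=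
  ∀ f g : modelSpace (reducedInner u),
    ⟪zShift u g, A (zShift u f)⟫_ℂ = ⟪inclusion u g, A (inclusion u f)⟫_ℂ

section Reduced

variable {u : LInf} (hu : IsInner u) (hu0 : diskValue (⇑u) 0 = 0)

include hu hu0 in
/-- Two functionals on `K_{u₁}` of the form `f ↦ ⟨T f, g⟩` agree if they agree on bounded
functions. -/
theorem inner_map_ext {S T : modelSpace (reducedInner u) →L[ℂ] modelSpace u} {x y : modelSpace u}
    (H : ∀ (f : modelSpace (reducedInner u)) (b : LInf), (f : L2) = mul b oneL2 →
      ⟪x, S f⟫_ℂ = ⟪y, T f⟫_ℂ) (f : modelSpace (reducedInner u)) : ⟪x, S f⟫_ℂ = ⟪y, T f⟫_ℂ :=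
  functional_ext (isInner_reducedInner hu hu0) (F := (innerSL ℂ x).comp S)
    (G := (innerSL ℂ y).comp T) H f

theorem zShift_bounded {f : modelSpace (reducedInner u)} {b : LInf} (hb : (f : L2) = mul b oneL2) :
    (zShift u f : L2) = mul (zInf • b : LInf) oneL2 := by
  rw [coe_zShift, smulInf_mul, hb]

include hu hu0 in
theorem shiftInvariant_of_tto {φ : L2} {A : modelSpace u →L[ℂ] modelSpace u}
    (hA : IsTTOWithSymbol u φ A) : ShiftInvariant u A := by
  intro f g
  have key := inner_map_ext hu hu0 (S := A.comp (zShift u)) (T := A.comp (inclusion u))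
    (x := zShift u g) (y := inclusion u g) (fun f b hb => by
      rw [ContinuousLinearMap.comp_apply, ContinuousLinearMap.comp_apply,
        inner_tto hA _ _ _ (zShift_bounded hb), inner_tto hA _ _ b (by rw [coe_inclusion, hb]),
        smulInf_mul, coe_zShift, inner_mul_mul zInf_unimodular, coe_inclusion]) f
  rwa [ContinuousLinearMap.comp_apply, ContinuousLinearMap.comp_apply] at key

/-- The backward shift on `K_u`. -/
def backward (hu : IsInner u) (hu0 : diskValue (⇑u) 0 = 0) (f : modelSpace u) :
    modelSpace (reducedInner u) :=
  (exists_eq_modelOne_add_zShift hu hu0 f).choose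

theorem eq_modelOne_add_zShift_backward (f : modelSpace u) :
    f = ⟪modelOne hu hu0, f⟫_ℂ • modelOne hu hu0 + zShift u (backward hu hu0 f) :=
  (exists_eq_modelOne_add_zShift hu hu0 f).choose_spec

theorem coe_eq_add_zInf_mul_backward (f : modelSpace u) :
    (f : L2) = ⟪oneL2, (f : L2)⟫_ℂ • oneL2 + mul zInf (backward hu hu0 f) :=
  congrArg Subtype.val (eq_modelOne_add_zShift_backward hu hu0 f)

theorem inner_fourierLp_backward (f : modelSpace u) (k : ℕ) :
    ⟪fourierLp 2 (k : ℤ), (backward hu hu0 f : L2)⟫_ℂ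
      = ⟪fourierLp 2 ((k + 1 : ℕ) : ℤ), (f : L2)⟫_ℂ := by
  conv_rhs => rw [coe_eq_add_zInf_mul_backward hu hu0 f]
  rw [inner_add_right, inner_smul_right, oneL2, inner_fourierLp, if_neg (by lia), mul_zero,
    zero_add, Nat.cast_succ, ← zInf_mul_fourierLp, inner_mul_mul zInf_unimodular]

theorem fourierInf_zero_mul (x : L2) : mul (fourierLp ∞ ((0 : ℕ) : ℤ)) x = x := by
  apply Lp.ext
  filter_upwards [mul_ae (fourierLp ∞ ((0 : ℕ) : ℤ)) x, fourierInf_ae ((0 : ℕ) : ℤ)] with t h1 h2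
  rw [h1, h2, Nat.cast_zero, fourier_zero, one_mul]

theorem fourierInf_succ_mul (k : ℕ) (x : L2) :
    mul (fourierLp ∞ ((k + 1 : ℕ) : ℤ)) x = mul zInf (mul (fourierLp ∞ (k : ℤ)) x) := by
  apply Lp.ext
  filter_upwards [mul_ae (fourierLp ∞ ((k + 1 : ℕ) : ℤ)) x, mul_ae (fourierLp ∞ (k : ℤ)) x,
    mul_ae zInf (mul (fourierLp ∞ (k : ℤ)) x), fourierInf_ae (k : ℤ), fourierInf_ae 1,
    fourierInf_ae ((k + 1 : ℕ) : ℤ)] with t h1 h2 h3 h4 h5 h6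
  rw [h1, h3, h2, zInf, h4, h5, h6, Nat.cast_succ, fourier_add]
  ring

theorem fourierInf_mul_mem_hardySpace (k : ℕ) {x : L2} (hx : x ∈ hardySpace) :
    mul (fourierLp ∞ (k : ℤ)) x ∈ hardySpace := by
  refine mul_mem_hardySpace (fun n hn => ?_) hx
  rw [fourierCoeffInf_eq_inner, fourierInf_mul_one, inner_fourierLp, if_neg (by lia)]

theorem inner_backward_fourierInf_mul (g : modelSpace u) (k : ℕ) {x : L2} (hx : x ∈ hardySpace) :
    ⟪(backward hu hu0 g : L2), mul (fourierLp ∞ (k : ℤ)) x⟫_ℂ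
      = ⟪(g : L2), mul (fourierLp ∞ ((k + 1 : ℕ) : ℤ)) x⟫_ℂ := by
  conv_rhs => rw [coe_eq_add_zInf_mul_backward hu hu0 g]
  rw [fourierInf_succ_mul, inner_add_left, inner_smul_left,
    inner_one_zInf_mul (fourierInf_mul_mem_hardySpace k hx), mul_zero, zero_add,
    inner_mul_mul zInf_unimodular]

/-- The backward shift, as a map of `K_u` into itself. -/
def backwardSelf (hu : IsInner u) (hu0 : diskValue (⇑u) 0 = 0) (f : modelSpace u) : modelSpace u :=
  inclusion u (backward hu hu0 f)

theorem coe_backwardSelf (f : modelSpace u) :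
    (backwardSelf hu hu0 f : L2) = backward hu hu0 f := by
  rw [backwardSelf, coe_inclusion]

theorem inner_fourierLp_backwardSelf (f : modelSpace u) (k : ℕ) :
    ⟪fourierLp 2 (k : ℤ), (backwardSelf hu hu0 f : L2)⟫_ℂ
      = ⟪fourierLp 2 ((k + 1 : ℕ) : ℤ), (f : L2)⟫_ℂ := by
  rw [coe_backwardSelf, inner_fourierLp_backward]

theorem inner_backwardSelf_fourierInf_mul (g : modelSpace u) (k : ℕ) {x : L2}
    (hx : x ∈ hardySpace) :
    ⟪(backwardSelf hu hu0 g : L2), mul (fourierLp ∞ (k : ℤ)) x⟫_ℂ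
      = ⟪(g : L2), mul (fourierLp ∞ ((k + 1 : ℕ) : ℤ)) x⟫_ℂ := by
  rw [coe_backwardSelf, inner_backward_fourierInf_mul hu hu0 g k hx]

theorem eq_sum_add_mul_backward_iterate (N : ℕ) (f : modelSpace u) :
    (f : L2) = ∑ k ∈ Finset.range N, ⟪fourierLp 2 (k : ℤ), (f : L2)⟫_ℂ • (fourierLp 2 (k : ℤ) : L2)
      + mul (fourierLp ∞ (N : ℤ)) ((backwardSelf hu hu0)^[N] f) := by
  induction N generalizing f with
  | zero =>
    rw [Finset.range_zero, Finset.sum_empty, zero_add, fourierInf_zero_mul,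
      Function.iterate_zero, id]
  | succ N ih =>
    have h1 := congrArg (mul zInf) (ih (backwardSelf hu hu0 f))
    rw [mul_add_L2, mul_sum_L2, ← fourierInf_succ_mul, ← Function.iterate_succ_apply] at h1
    have h2 : ∀ k ∈ Finset.range N, mul zInf (⟪fourierLp 2 (k : ℤ), (backwardSelf hu hu0 f : L2)⟫_ℂ
          • (fourierLp 2 (k : ℤ) : L2))
        = ⟪fourierLp 2 ((k + 1 : ℕ) : ℤ), (f : L2)⟫_ℂ • (fourierLp 2 ((k + 1 : ℕ) : ℤ) : L2) := by
      intro k _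
      rw [mul_smul_L2, zInf_mul_fourierLp, inner_fourierLp_backwardSelf, Nat.cast_succ]
    rw [Finset.sum_congr rfl h2] at h1
    have h3 := coe_eq_add_zInf_mul_backward hu hu0 f
    rw [← coe_backwardSelf, h1, ← add_assoc, add_comm (_ • _)] at h3
    rw [Finset.sum_range_succ', Nat.cast_zero]
    exact h3

theorem hasSum_nat_of_hardySpace {f : L2} (hf : f ∈ hardySpace) :
    HasSum (fun n : ℕ => ⟪fourierLp 2 (n : ℤ), f⟫_ℂ • (fourierLp 2 (n : ℤ) : L2)) f := by
  refine (Nat.cast_injective (R := ℤ)).hasSum_iff (f := fun n : ℤ =>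
    ⟪fourierLp 2 n, f⟫_ℂ • (fourierLp 2 n : L2)) (fun n hn => ?_) |>.mpr (hasSum_fourierLp f)
  rw [mem_hardySpace.mp hf n, zero_smul]
  by_contra! h
  exact hn ⟨n.toNat, Int.toNat_of_nonneg h⟩

theorem tendsto_backward_iterate (f : modelSpace u) :
    Tendsto (fun N => ‖(backwardSelf hu hu0)^[N] f‖) atTop (𝓝 0) := by
  have h1 := (hasSum_nat_of_hardySpace (mem_modelSpace.mp f.2).1).tendsto_sum_nat
  rw [← tendsto_sub_nhds_zero_iff, tendsto_zero_iff_norm_tendsto_zero] at h1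
  refine h1.congr fun N => ?_
  have h2 := eq_sum_add_mul_backward_iterate hu hu0 N f
  rw [norm_sub_rev, ← eq_sub_iff_add_eq'.mpr h2.symm, Submodule.coe_norm]
  rw [@norm_eq_sqrt_re_inner ℂ, @norm_eq_sqrt_re_inner ℂ,
    inner_mul_mul (fourierInf_unimodular N)]

theorem inner_mul_one_mul (c d : LInf) (a : L2) :
    ⟪mul c oneL2, mul d a⟫_ℂ = ⟪mul c (star a), mul d oneL2⟫_ℂ := by
  rw [← inner_star_star, star_mul_L2, star_mul_L2, star_one_L2, inner_mul_left_eq, star_star,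
    mul_comm_mul, ← inner_mul_left_eq]

/-- Pairing of the Taylor partial sums of a bounded analytic function with an `L²` function. -/
theorem hasSum_inner_fourierInf_mul {b c : LInf} (hb : mul b oneL2 ∈ hardySpace) (a : L2) :
    HasSum (fun k : ℕ => ⟪fourierLp 2 (k : ℤ), mul b oneL2⟫_ℂ
      * ⟪mul c oneL2, mul (fourierLp ∞ (k : ℤ)) a⟫_ℂ) ⟪mul c oneL2, mul b a⟫_ℂ := by
  rw [inner_mul_one_mul]
  convert! (innerSL ℂ (mul c (star a))).hasSum (hasSum_nat_of_hardySpace hb) using 2 with k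
  rw [inner_mul_one_mul, fourierInf_mul_one, innerSL_apply_apply, inner_smul_right]

theorem inner_eq_sum_add_inner_backward {A : modelSpace u →L[ℂ] modelSpace u}
    (hA : ShiftInvariant u A) {b : modelSpace u}
    (hb : ∀ f : modelSpace (reducedInner u),
      ⟪b, zShift u f⟫_ℂ = ⟪modelOne hu hu0, A (zShift u f)⟫_ℂ)
    (hb0 : ⟪b, modelOne hu hu0⟫_ℂ = 0) (N : ℕ) (f g : modelSpace u) :
    ⟪g, A f⟫_ℂ = ∑ k ∈ Finset.range N,
        (⟪fourierLp 2 (k : ℤ), (f : L2)⟫_ℂ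
            * ⟪(g : L2), mul (fourierLp ∞ (k : ℤ)) (A (modelOne hu hu0))⟫_ℂ
          + (starRingEnd ℂ) (⟪fourierLp 2 (k : ℤ), (g : L2)⟫_ℂ
            * ⟪(f : L2), mul (fourierLp ∞ (k : ℤ)) b⟫_ℂ))
      + ⟪(backwardSelf hu hu0)^[N] g, A ((backwardSelf hu hu0)^[N] f)⟫_ℂ := by
  induction N generalizing f g with
  | zero => simp
  | succ N ih =>
    have step : ⟪g, A f⟫_ℂ = ⟪modelOne hu hu0, f⟫_ℂ * ⟪g, A (modelOne hu hu0)⟫_ℂ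
        + (starRingEnd ℂ) (⟪modelOne hu hu0, g⟫_ℂ * ⟪f, b⟫_ℂ)
        + ⟪backwardSelf hu hu0 g, A (backwardSelf hu hu0 f)⟫_ℂ := by
      have h1 : ⟪b, f⟫_ℂ = ⟪modelOne hu hu0, A (zShift u (backward hu hu0 f))⟫_ℂ := by
        conv_lhs => rw [eq_modelOne_add_zShift_backward hu hu0 f]
        rw [inner_add_right, model_inner_smul_right, hb0, mul_zero, zero_add, hb]
      have h2 : ⟪g, A (zShift u (backward hu hu0 f))⟫_ℂ
          = (starRingEnd ℂ) ⟪modelOne hu hu0, g⟫_ℂ * ⟪b, f⟫_ℂ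
            + ⟪backwardSelf hu hu0 g, A (backwardSelf hu hu0 f)⟫_ℂ := by
        conv_lhs => rw [eq_modelOne_add_zShift_backward hu hu0 g]
        rw [inner_add_left, model_inner_smul_left, hA, h1]
        rfl
      conv_lhs => rw [eq_modelOne_add_zShift_backward hu hu0 f]
      rw [map_add, map_smul, inner_add_right, model_inner_smul_right, h2, map_mul,
        model_inner_conj_symm b f]
      ring
    have hs : ∀ k ∈ Finset.range N,
        ⟪fourierLp 2 (k : ℤ), (backwardSelf hu hu0 f : L2)⟫_ℂ
            * ⟪(backwardSelf hu hu0 g : L2),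
              mul (fourierLp ∞ (k : ℤ)) (A (modelOne hu hu0))⟫_ℂ
          + (starRingEnd ℂ) (⟪fourierLp 2 (k : ℤ), (backwardSelf hu hu0 g : L2)⟫_ℂ
            * ⟪(backwardSelf hu hu0 f : L2), mul (fourierLp ∞ (k : ℤ)) b⟫_ℂ)
        = ⟪fourierLp 2 ((k + 1 : ℕ) : ℤ), (f : L2)⟫_ℂ
            * ⟪(g : L2), mul (fourierLp ∞ ((k + 1 : ℕ) : ℤ)) (A (modelOne hu hu0))⟫_ℂ
          + (starRingEnd ℂ) (⟪fourierLp 2 ((k + 1 : ℕ) : ℤ), (g : L2)⟫_ℂ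
            * ⟪(f : L2), mul (fourierLp ∞ ((k + 1 : ℕ) : ℤ)) b⟫_ℂ) := by
      intro k _
      rw [inner_fourierLp_backwardSelf, inner_fourierLp_backwardSelf,
        inner_backwardSelf_fourierInf_mul hu hu0 _ _ (mem_modelSpace.mp b.2).1,
        inner_backwardSelf_fourierInf_mul hu hu0 _ _ (mem_modelSpace.mp (Subtype.property _)).1]
    rw [step, ih (backwardSelf hu hu0 f) (backwardSelf hu hu0 g),
      Finset.sum_congr rfl hs, Finset.sum_range_succ', fourierInf_zero_mul,
      fourierInf_zero_mul, Function.iterate_succ_apply, Function.iterate_succ_apply, ← add_assoc,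
      add_comm (_ + _) (∑ k ∈ _, _), Submodule.coe_inner, Submodule.coe_inner, Submodule.coe_inner,
      Submodule.coe_inner, coe_modelOne, oneL2, Nat.cast_zero]

include hu hu0 in
theorem tto_of_shiftInvariant {A : modelSpace u →L[ℂ] modelSpace u} (hA : ShiftInvariant u A) :
    A ∈ ttoSet u := by
  set o := modelOne hu hu0
  have hoo : ⟪o, o⟫_ℂ = 1 := inner_modelOne_modelOne hu hu0
  set b : modelSpace u :=
    ContinuousLinearMap.adjoint A o - (starRingEnd ℂ) ⟪o, A o⟫_ℂ • o with hbdef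
  have hb : ∀ f, ⟪b, f⟫_ℂ = ⟪o, A f⟫_ℂ - ⟪o, A o⟫_ℂ * ⟪o, f⟫_ℂ := by
    intro f
    rw [hbdef, inner_sub_left, model_inner_smul_left, RingHomCompTriple.comp_apply, RingHom.id_apply,
      ContinuousLinearMap.adjoint_inner_left]
  refine ⟨A o + star (b : L2), fun f c hc => ?_⟩
  rw [ae_eq_iff_eq_mul_one] at hc
  rw [← sub_eq_zero]
  refine Subtype.ext (eq_zero_of_inner_bounded hu (Subtype.property _) fun d hd => ?_)
  set g : modelSpace u := ⟨_, hd⟩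
  have hfH := (mem_modelSpace.mp f.2).1
  have hgH := (mem_modelSpace.mp g.2).1
  suffices h : ⟪g, A f⟫_ℂ = ⟪(g : L2), mul c (A o + star (b : L2))⟫_ℂ by
    change ⟪g, A f - _⟫_ℂ = 0
    rw [inner_sub_right, h, inner_projection, sub_self]
  have s1 := hasSum_inner_fourierInf_mul (c := d) (hc ▸ hfH) (A o : L2)
  have s2 := (hasSum_inner_fourierInf_mul (c := c) hgH (b : L2)).star
  have t1 := (s1.add s2).tendsto_sum_nat
  have t2 : Tendsto (fun N => ⟪(backwardSelf hu hu0)^[N] g, A ((backwardSelf hu hu0)^[N] f)⟫_ℂ)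
      atTop (𝓝 0) := by
    have t3 := ((tendsto_backward_iterate hu hu0 g).mul
      ((tendsto_backward_iterate hu hu0 f).const_mul ‖A‖))
    rw [mul_zero, mul_zero] at t3
    refine squeeze_zero_norm (fun N => (norm_model_inner_le _ _).trans ?_) t3
    gcongr
    exact A.le_opNorm _
  have t4 := t1.add t2
  rw [add_zero] at t4
  have e : ⟪mul d oneL2, mul c (star (b : L2))⟫_ℂ = star ⟪mul c oneL2, mul d (b : L2)⟫_ℂ := by
    rw [inner_mul_one_mul, star_star]; exact (inner_conj_symm _ _).symm
  rw [mul_add_L2, inner_add_right, e]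
  refine tendsto_nhds_unique (tendsto_const_nhds.congr fun N => ?_) t4
  rw [inner_eq_sum_add_inner_backward hu hu0 hA
    (fun f => by rw [hb, inner_modelOne_zShift, mul_zero, sub_zero])
    (by rw [hb, hoo, mul_one, sub_self]) N f g, hc]
  rfl

end Reduced

theorem mem_ttoSet_iff {u : LInf} (hu : IsInner u) (hu0 : diskValue (⇑u) 0 = 0)
    {A : modelSpace u →L[ℂ] modelSpace u} : A ∈ ttoSet u ↔ ShiftInvariant u A :=
  ⟨fun ⟨_, h⟩ => shiftInvariant_of_tto hu hu0 h, tto_of_shiftInvariant hu hu0⟩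

/-! ### Products of truncated Toeplitz operators -/

section Product

variable {u : LInf} (hu : IsInner u) (hu0 : diskValue (⇑u) 0 = 0)

theorem exists_zShift_of_mem {f : L2} (hf : f ∈ zModelSpace u) :
    ∃ k : modelSpace (reducedInner u), (zShift u k : L2) = f := by
  obtain ⟨k, hk, rfl⟩ := hf
  exact ⟨⟨k, hk⟩, coe_zShift _⟩

theorem zShift_mem_zModelSpace (k : modelSpace (reducedInner u)) :
    (zShift u k : L2) ∈ zModelSpace u :=
  ⟨k, k.2, (coe_zShift k).symm⟩

theorem mem_modelSpace_of_mem_zModelSpace {f : L2} (hf : f ∈ zModelSpace u) :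
    f ∈ modelSpace u := by
  obtain ⟨k, rfl⟩ := exists_zShift_of_mem hf
  exact (zShift u k).2

theorem inner_one_of_mem_zModelSpace {f : L2} (hf : f ∈ zModelSpace u) : ⟪oneL2, f⟫_ℂ = 0 := by
  obtain ⟨k, hk, rfl⟩ := hf
  exact inner_one_zInf_mul (mem_modelSpace.mp hk).1

theorem mem_hardySpace_of_mem_zModelSpace {f : L2} (hf : f ∈ zModelSpace u) : f ∈ hardySpace :=
  (mem_modelSpace.mp (mem_modelSpace_of_mem_zModelSpace hf)).1

theorem breve_eq (f : L2) : breve u f = mul u (star f) :=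
  zInf_mul_reducedInner_mul u (star f)

include hu hu0 in
theorem breve_mem_zModelSpace {f : L2} (hf : f ∈ zModelSpace u) : breve u f ∈ zModelSpace u := by
  have hfH := mem_hardySpace_of_mem_zModelSpace hf
  refine ⟨mul (reducedInner u) (star f), mem_modelSpace.mpr ⟨?_, fun h hh => ?_⟩, rfl⟩
  · refine mem_hardySpace.mpr fun n hn => ?_
    rw [← inner_star_star, star_mul_L2, star_star, star_fourierLp, ← inner_mul_right_eq,
      inner_eq_zero_symm, show -n = (-n - 1) + 1 by ring, ← zInf_mul_fourierLp,
      reducedInner_mul_zInf_mul]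
    exact (mem_modelSpace.mp (mem_modelSpace_of_mem_zModelSpace hf)).2 _
      (fourierLp_mem_hardySpace (by lia))
  · rw [inner_reducedInner_mul_mul hu hu0]
    exact inner_star_eq_zero hh hfH (inner_one_of_mem_zModelSpace hf)

theorem IsDecomposition.star {φ φp φm : L2} {φ₀ : ℂ} (h : IsDecomposition u φ φp φm φ₀) :
    IsDecomposition u (star φ) φm φp ((starRingEnd ℂ) φ₀) where
  plus_mem := h.minus_mem
  minus_mem := h.plus_mem
  eq := by
    rw [h.eq, star_add_L2, star_add_L2, star_smul_L2, star_star, star_one_L2,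
      add_comm (Star.star φp)]

theorem inner_symbol {φ φp φm : L2} {φ₀ : ℂ} (h : IsDecomposition u φ φp φm φ₀)
    {x : L2} (hx : x ∈ zModelSpace u) : ⟪x, φ⟫_ℂ = ⟪x, φp⟫_ℂ := by
  rw [h.eq, inner_add_right, inner_add_right, inner_smul_right,
    inner_star_eq_zero (mem_hardySpace_of_mem_zModelSpace hx)
      (mem_hardySpace_of_mem_zModelSpace h.minus_mem) (inner_one_of_mem_zModelSpace h.minus_mem),
    inner_eq_zero_symm.mp (inner_one_of_mem_zModelSpace hx), mul_zero, add_zero, add_zero]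

theorem inner_mul_symbol {φ φp φm : L2} {φ₀ : ℂ} (h : IsDecomposition u φ φp φm φ₀)
    {x : L2} (hx : x ∈ zModelSpace u) : ⟪x, mul u φ⟫_ℂ = ⟪x, breve u φm⟫_ℂ := by
  have hz : ∀ g ∈ hardySpace, ⟪x, mul u g⟫_ℂ = 0 := fun g hg =>
    inner_eq_zero_symm.mp ((mem_modelSpace.mp (mem_modelSpace_of_mem_zModelSpace hx)).2 g hg)
  rw [h.eq, mul_add_L2, mul_add_L2, mul_smul_L2, inner_add_right, inner_add_right,
    inner_smul_right, hz _ one_mem_hardySpace, hz _ (mem_hardySpace_of_mem_zModelSpace h.plus_mem),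
    breve_eq, mul_zero, add_zero, zero_add]

theorem inner_symbol_left {φ φp φm : L2} {φ₀ : ℂ} (h : IsDecomposition u φ φp φm φ₀)
    {x : L2} (hx : x ∈ zModelSpace u) : ⟪φ, x⟫_ℂ = ⟪φp, x⟫_ℂ := by
  rw [← inner_conj_symm, inner_symbol h hx, inner_conj_symm]

theorem inner_mul_symbol_left {φ φp φm : L2} {φ₀ : ℂ} (h : IsDecomposition u φ φp φm φ₀)
    {x : L2} (hx : x ∈ zModelSpace u) : ⟪mul u φ, x⟫_ℂ = ⟪breve u φm, x⟫_ℂ := by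
  rw [← inner_conj_symm, inner_mul_symbol h hx, inner_conj_symm]

variable {φ φp φm : L2} {φ₀ : ℂ} (hφ : IsDecomposition u φ φp φm φ₀)
  {A : modelSpace u →L[ℂ] modelSpace u} (hA : IsTTOWithSymbol u φ A)

include hφ hA in
theorem inner_zShift_map_one (g : modelSpace (reducedInner u)) :
    ⟪zShift u g, A (modelOne hu hu0)⟫_ℂ = ⟪(zShift u g : L2), φp⟫_ℂ := by
  rw [inner_tto hA _ _ (fourierLp ∞ ((0 : ℕ) : ℤ)) (by rw [fourierInf_zero_mul, coe_modelOne]),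
    fourierInf_zero_mul, inner_symbol hφ (zShift_mem_zModelSpace g)]

include hφ hA in
theorem inner_inclusion_map_reduced (g : modelSpace (reducedInner u)) :
    ⟪inclusion u g, A (modelReduced hu hu0)⟫_ℂ = ⟪(zShift u g : L2), breve u φm⟫_ℂ := by
  rw [inner_tto hA _ _ (reducedInner u) (coe_modelReduced hu hu0), coe_inclusion,
    ← inner_mul_mul zInf_unimodular, zInf_mul_reducedInner_mul,
    ← inner_mul_symbol hφ (zShift_mem_zModelSpace g), coe_zShift]

include hφ hA in
theorem inner_one_map_zShift (f : modelSpace (reducedInner u)) :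
    ⟪modelOne hu hu0, A (zShift u f)⟫_ℂ = ⟪φm, (zShift u f : L2)⟫_ℂ := by
  have key := functional_ext (isInner_reducedInner hu hu0)
    (F := (innerSL ℂ (modelOne hu hu0)).comp (A.comp (zShift u)))
    (G := (innerSL ℂ φm).comp ((modelSpace u).subtypeL.comp (zShift u))) (fun f b hb => by
      rw [ContinuousLinearMap.comp_apply, ContinuousLinearMap.comp_apply,
        ContinuousLinearMap.comp_apply, ContinuousLinearMap.comp_apply, Submodule.subtypeL_apply,
        innerSL_apply_apply, innerSL_apply_apply, inner_tto hA _ _ _ (zShift_bounded hb),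
        ← inner_symbol_left hφ.star (zShift_mem_zModelSpace f), zShift_bounded hb, coe_modelOne,
        inner_star_left, star_mul_L2, star_one_L2, ← inner_mul_right_eq]) f
  rwa [ContinuousLinearMap.comp_apply, ContinuousLinearMap.comp_apply,
    ContinuousLinearMap.comp_apply, ContinuousLinearMap.comp_apply, Submodule.subtypeL_apply,
    innerSL_apply_apply, innerSL_apply_apply] at key

include hφ hA in
theorem inner_reduced_map_inclusion (f : modelSpace (reducedInner u)) :
    ⟪modelReduced hu hu0, A (inclusion u f)⟫_ℂ = ⟪breve u φp, (zShift u f : L2)⟫_ℂ := by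
  have key := functional_ext (isInner_reducedInner hu hu0)
    (F := (innerSL ℂ (modelReduced hu hu0)).comp (A.comp (inclusion u)))
    (G := (innerSL ℂ (breve u φp)).comp ((modelSpace u).subtypeL.comp (zShift u)))
    (fun f b hb => by
      rw [ContinuousLinearMap.comp_apply, ContinuousLinearMap.comp_apply,
        ContinuousLinearMap.comp_apply, ContinuousLinearMap.comp_apply, Submodule.subtypeL_apply,
        innerSL_apply_apply, innerSL_apply_apply,
        inner_tto hA _ _ b (by rw [coe_inclusion, hb]),
        ← inner_mul_symbol_left hφ.star (zShift_mem_zModelSpace f), coe_modelReduced,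
        inner_mul_one_mul, coe_zShift, ← zInf_mul_reducedInner_mul u,
        inner_mul_mul zInf_unimodular, hb]) f
  rwa [ContinuousLinearMap.comp_apply, ContinuousLinearMap.comp_apply,
    ContinuousLinearMap.comp_apply, ContinuousLinearMap.comp_apply, Submodule.subtypeL_apply,
    innerSL_apply_apply, innerSL_apply_apply] at key

/-- The failure of a product of shift invariant operators to be shift invariant. -/
theorem inner_comp_sub {A B : modelSpace u →L[ℂ] modelSpace u} (hA : ShiftInvariant u A)
    (hB : ShiftInvariant u B) (f g : modelSpace (reducedInner u)) :
    ⟪zShift u g, A (B (zShift u f))⟫_ℂ - ⟪inclusion u g, A (B (inclusion u f))⟫_ℂ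
      = ⟪modelOne hu hu0, B (zShift u f)⟫_ℂ * ⟪zShift u g, A (modelOne hu hu0)⟫_ℂ
        - ⟪modelReduced hu hu0, B (inclusion u f)⟫_ℂ
          * ⟪inclusion u g, A (modelReduced hu hu0)⟫_ℂ := by
  obtain ⟨h, hh⟩ := exists_eq_modelOne_add_zShift hu hu0 (B (zShift u f))
  obtain ⟨k, hk⟩ := exists_eq_modelReduced_add_inclusion hu hu0 (B (inclusion u f))
  have hhk : h = k := by
    refine ext_inner_left ℂ fun w => ?_
    have e := hB f w
    rw [hh, hk, inner_add_right, inner_add_right, model_inner_smul_right, model_inner_smul_right,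
      ← model_inner_conj_symm (zShift u w) (modelOne hu hu0), inner_modelOne_zShift,
      ← model_inner_conj_symm (inclusion u w) (modelReduced hu hu0), inner_modelReduced_inclusion,
      map_zero, mul_zero, mul_zero, zero_add, zero_add, inner_zShift_zShift,
      inner_inclusion_inclusion] at e
    exact e
  have e1 : ⟪zShift u g, A (B (zShift u f))⟫_ℂ
      = ⟪modelOne hu hu0, B (zShift u f)⟫_ℂ * ⟪zShift u g, A (modelOne hu hu0)⟫_ℂ
        + ⟪zShift u g, A (zShift u h)⟫_ℂ := by
    conv_lhs => rw [hh]
    rw [map_add, map_smul, inner_add_right, model_inner_smul_right]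
  have e2 : ⟪inclusion u g, A (B (inclusion u f))⟫_ℂ
      = ⟪modelReduced hu hu0, B (inclusion u f)⟫_ℂ * ⟪inclusion u g, A (modelReduced hu hu0)⟫_ℂ
        + ⟪inclusion u g, A (inclusion u k)⟫_ℂ := by
    conv_lhs => rw [hk]
    rw [map_add, map_smul, inner_add_right, model_inner_smul_right]
  rw [e1, e2, hA, hhk]
  ring

variable {ψ ψp ψm : L2} {ψ₀ : ℂ} (hψ : IsDecomposition u ψ ψp ψm ψ₀)
  {B : modelSpace u →L[ℂ] modelSpace u} (hB : IsTTOWithSymbol u ψ B)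

include hu hu0 hφ hA hψ hB in
theorem inner_comp_sub_eq_tensor (f g : modelSpace (reducedInner u)) :
    ⟪zShift u g, A (B (zShift u f))⟫_ℂ - ⟪inclusion u g, A (B (inclusion u f))⟫_ℂ
      = ⟪(zShift u g : L2),
          (tensor u φp ψm - tensor u (breve u φm) (breve u ψp)) (zShift u f)⟫_ℂ := by
  rw [inner_comp_sub hu hu0 (shiftInvariant_of_tto hu hu0 hA) (shiftInvariant_of_tto hu hu0 hB),
    inner_zShift_map_one hu hu0 hφ hA, inner_inclusion_map_reduced hu hu0 hφ hA,
    inner_one_map_zShift hu hu0 hψ hB, inner_reduced_map_inclusion hu hu0 hψ hB,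
    sub_apply, tensor_apply, tensor_apply, inner_sub_right, inner_smul_right,
    inner_smul_right]

include hu hu0 in
/-- Operators `K_u → L²(𝕋)` with range in `z K_{u₁}` that vanish at `1` are determined by their
forms on `z K_{u₁}`. -/
theorem eq_of_inner_zShift {S T : modelSpace u →L[ℂ] L2} (hS1 : S (modelOne hu hu0) = 0)
    (hT1 : T (modelOne hu hu0) = 0) (hS : ∀ x, S x ∈ zModelSpace u)
    (hT : ∀ x, T x ∈ zModelSpace u)
    (H : ∀ f g : modelSpace (reducedInner u),
      ⟪(zShift u g : L2), S (zShift u f)⟫_ℂ = ⟪(zShift u g : L2), T (zShift u f)⟫_ℂ) : S = T := by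
  refine ContinuousLinearMap.ext fun x => ?_
  obtain ⟨f, hf⟩ := exists_eq_modelOne_add_zShift hu hu0 x
  rw [hf, map_add, map_add, map_smul, map_smul, hS1, hT1, smul_zero, zero_add, zero_add,
    ← sub_eq_zero]
  obtain ⟨k, hk⟩ := exists_zShift_of_mem (Submodule.sub_mem _ (hS (zShift u f)) (hT (zShift u f)))
  refine inner_self_eq_zero (𝕜 := ℂ).mp ?_
  nth_rw 1 [← hk]
  rw [inner_sub_right, H, sub_self]

include hu hu0 in
theorem tensor_sub_apply_one {f g f' g' : L2} (hg : g ∈ zModelSpace u) (hg' : g' ∈ zModelSpace u) :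
    (tensor u f g - tensor u f' g') (modelOne hu hu0) = 0 := by
  rw [sub_apply, tensor_apply, tensor_apply, coe_modelOne,
    inner_eq_zero_symm.mp (inner_one_of_mem_zModelSpace hg),
    inner_eq_zero_symm.mp (inner_one_of_mem_zModelSpace hg'), zero_smul, zero_smul, sub_zero]

theorem tensor_sub_apply_mem {f g f' g' : L2} (hf : f ∈ zModelSpace u) (hf' : f' ∈ zModelSpace u)
    (x : modelSpace u) : (tensor u f g - tensor u f' g') x ∈ zModelSpace u := by
  rw [sub_apply, tensor_apply, tensor_apply]
  exact Submodule.sub_mem _ (Submodule.smul_mem _ _ hf) (Submodule.smul_mem _ _ hf')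

end Product

end TruncatedToeplitz

end

open TruncatedToeplitz in
theorem mainTheorem4 (u : LInf) (hu : IsInner u) (hu0 : diskValue (⇑u) 0 = 0)
    (φ φp φm : L2) (φ₀ : ℂ) (hφ : IsDecomposition u φ φp φm φ₀)
    (ψ ψp ψm : L2) (ψ₀ : ℂ) (hψ : IsDecomposition u ψ ψp ψm ψ₀)
    (ζ ζp ζm : L2) (ζ₀ : ℂ) (hζ : IsDecomposition u ζ ζp ζm ζ₀)
    (η ηp ηm : L2) (η₀ : ℂ) (hη : IsDecomposition u η ηp ηm η₀)
    (Aφ Aψ Aζ Aη : modelSpace u →L[ℂ] modelSpace u)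
    (hAφ : IsTTOWithSymbol u φ Aφ) (hAψ : IsTTOWithSymbol u ψ Aψ)
    (hAζ : IsTTOWithSymbol u ζ Aζ) (hAη : IsTTOWithSymbol u η Aη) :
    Aφ ∘L Aψ - Aζ ∘L Aη ∈ ttoSet u ↔
      tensor u φp ψm - tensor u (breve u φm) (breve u ψp) =
        tensor u ζp ηm - tensor u (breve u ζm) (breve u ηp) := by
  have key : ∀ f g, ⟪zShift u g, (Aφ ∘L Aψ - Aζ ∘L Aη) (zShift u f)⟫_ℂ
        - ⟪inclusion u g, (Aφ ∘L Aψ - Aζ ∘L Aη) (inclusion u f)⟫_ℂ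
      = ⟪(zShift u g : L2),
          (tensor u φp ψm - tensor u (breve u φm) (breve u ψp)) (zShift u f)⟫_ℂ
        - ⟪(zShift u g : L2),
          (tensor u ζp ηm - tensor u (breve u ζm) (breve u ηp)) (zShift u f)⟫_ℂ := by
    intro f g
    rw [← inner_comp_sub_eq_tensor hu hu0 hφ hAφ hψ hAψ f g,
      ← inner_comp_sub_eq_tensor hu hu0 hζ hAζ hη hAη f g, sub_apply, sub_apply,
      ContinuousLinearMap.comp_apply, ContinuousLinearMap.comp_apply,
      ContinuousLinearMap.comp_apply, ContinuousLinearMap.comp_apply, inner_sub_right,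
      inner_sub_right]
    ring
  rw [mem_ttoSet_iff hu hu0]
  constructor
  · intro h
    refine eq_of_inner_zShift hu hu0
      (tensor_sub_apply_one hu hu0 hψ.minus_mem (breve_mem_zModelSpace hu hu0 hψ.plus_mem))
      (tensor_sub_apply_one hu hu0 hη.minus_mem (breve_mem_zModelSpace hu hu0 hη.plus_mem))
      (tensor_sub_apply_mem hφ.plus_mem (breve_mem_zModelSpace hu hu0 hφ.minus_mem))
      (tensor_sub_apply_mem hζ.plus_mem (breve_mem_zModelSpace hu hu0 hζ.minus_mem))
      fun f g => ?_
    rw [← sub_eq_zero, ← key, h f g, sub_self]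
  · intro h f g
    rw [← sub_eq_zero, key, h, sub_self]
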